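/- A linear convolutional network (LCN) architecture of depth $L \ge 1$ consists of positive integers $\boldsymbol d = (d_0,\dots,d_L)$ (dimensions), $\boldsymbol k = (k_1,\dots,k_L)$ (filter sizes) and $\boldsymbol s=(s_1,\dots,s_L)$ (strides) with $d_l = \frac{d_{l-1}-k_l}{s_l}+1$ for $1\le l\le L$. For positive integers $p, q, \kappa, \sigma$, a real $p\times q$ matrix $W$ is called convolutional with filter size $\kappa$ and stride $\sigma$ if there is a filter $w=(w_0,\dots,w_{\kappa-1})\in\mathbb R^{\kappa}$ such that, with rows and columns indexed from $0$, $W_{i,\,i\sigma+j}=w_j$ for $0\le j<\kappa$ (whenever this column exists) and all other entries of row $i$ vanish; that is, $(Wx)_i=\sum_{j=0}^{\kappa-1} w_j x_{i\sigma+j}$. Let $\mathcal M_{(q,p),\kappa,\sigma}\subseteq\mathbb R^{p\times q}$ be the vector space of these matrices. The function space of the architecture is $$\mathcal M_{\boldsymbol d,\boldsymbol k,\boldsymbol s}=\{W_L W_{L-1}\cdots W_1 : W_l\in\mathcal M_{(d_{l-1},d_l),k_l,s_l},\ 1\le l\le L\}\subseteq\mathbb R^{d_L\times d_0}.$$ Put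 $k=k_1+\sum_{l=2}^{L}(k_l-1)\prod_{m=1}^{l-1}s_m$ and $s=\prod_{l=1}^{L}s_l$. The architecture is called filling if $\mathcal M_{\boldsymbol d,\boldsymbol k,\boldsymbol s}=\mathcal M_{(d_0,d_L),k,s}$. A subset of a space $\mathbb R^N$ is semi-algebraic if it is a finite union of solution sets of finite systems of polynomial equations and polynomial inequalities with real coefficients; its dimension is the Krull dimension of the ring $\mathbb R[x_1,\dots,x_N]$ modulo the ideal of all polynomials vanishing on it. Proposition. Suppose that $k_L>1$ and that $s_i>1$ for some $i\le L-1$. Then the architecture is not filling. In fact, $\mathcal M_{\boldsymbol d,\boldsymbol k,\boldsymbol s}$ is a semi-algebraic subset of $\mathcal M_{(d_0,d_L),k,s}$ (as a set of points of $\mathbb R^{d_L\times d_0}$), and $$\dim \mathcal M_{\boldsymbol d,\boldsymbol k,\boldsymbol s}<\dim\mathcal M_{(d_0,d_L),k,s}.$$ -/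

import Mathlib

/-! Linear convolutional networks on one-dimensional signals (single filter per layer, no bias,
no padding), and semi-algebraic sets with their dimension. -/

namespace LCN

/-- The `m × n` convolutional (generalized Toeplitz) matrix with filter `w = (w₀, …, w_{k-1})` and
stride `s`: it represents the map `x ↦ (∑ j, w j * x (i * s + j))ᵢ`, so its row `i` contains `w`
starting in column `i * s` and is zero elsewhere. -/
def convMatrix (m n k s : ℕ) (w : Fin k → ℝ) : Matrix (Fin m) (Fin n) ℝ :=
  Matrix.of fun i t => ∑ j : Fin k, if (t : ℕ) = (i : ℕ) * s + (j : ℕ) then w j else 0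

/-- The set (a vector space) of `m × n` convolutional matrices with filter size `k`
and stride `s`. -/
def convSpace (m n k s : ℕ) : Set (Matrix (Fin m) (Fin n) ℝ) :=
  Set.range (convMatrix m n k s)

/-- An LCN architecture with `L` layers. Layer `l : Fin L` (counted from `0`) goes from dimension
`d l.castSucc` to dimension `d l.succ`, and has filter size `k l` and stride `s l`.
The sizes are positive and satisfy the compatibility relation of unpadded convolutions. -/
structure Architecture (L : ℕ) where
  d : Fin (L + 1) → ℕ
  k : Fin L → ℕ
  s : Fin L → ℕ
  d_pos : ∀ l, 0 < d l
  k_pos : ∀ l, 0 < k l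
  s_pos : ∀ l, 0 < s l
  compatible : ∀ l : Fin L,
    (d l.succ : ℚ) = ((d l.castSucc : ℚ) - (k l : ℚ)) / (s l : ℚ) + 1

/-- The product `W_{L-1} ⋯ W_1 W_0` of a composable chain of matrices. -/
def chainProd : (L : ℕ) → (d : Fin (L + 1) → ℕ) →
    ((l : Fin L) → Matrix (Fin (d l.succ)) (Fin (d l.castSucc)) ℝ) →
    Matrix (Fin (d (Fin.last L))) (Fin (d 0)) ℝ
  | 0, d, _ => (1 : Matrix (Fin (d 0)) (Fin (d 0)) ℝ)
  | L + 1, d, W =>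
      W (Fin.last L) * chainProd L (fun i => d i.castSucc) (fun l => W l.castSucc)

namespace Architecture

variable {L : ℕ} (A : Architecture L)

/-- The function space: all products of convolutional matrices of the prescribed sizes, filter
sizes and strides. -/
def functionSpace : Set (Matrix (Fin (A.d (Fin.last L))) (Fin (A.d 0)) ℝ) :=
  {V | ∃ W : (l : Fin L) → Matrix (Fin (A.d l.succ)) (Fin (A.d l.castSucc)) ℝ,
    (∀ l, W l ∈ convSpace (A.d l.succ) (A.d l.castSucc) (A.k l) (A.s l)) ∧
    V = chainProd L A.d W}

/-- The end-to-end filter size `1 + ∑ l, (k l - 1) * ∏ m < l, s m`. As filter sizes are positive,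
the `1` and the summand of the first layer together are the filter size of the first layer. -/
def filterSize : ℕ :=
  1 + ∑ l : Fin L, (A.k l - 1) * ∏ m ∈ Finset.univ.filter (fun m => m < l), A.s m

/-- The end-to-end stride. -/
def stride : ℕ := ∏ l : Fin L, A.s l

/-- The ambient space of the function space: the convolutional matrices with the
end-to-end filter size and the end-to-end stride. -/
def ambientSpace : Set (Matrix (Fin (A.d (Fin.last L))) (Fin (A.d 0)) ℝ) :=
  convSpace (A.d (Fin.last L)) (A.d 0) A.filterSize A.stride

/-- The architecture is filling if its function space is the whole ambient space. -/
def IsFilling : Prop := A.functionSpace = A.ambientSpace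

end Architecture

/-- The solution set in `ℝ^ι` of finitely many polynomial equations and strict inequalities.
(A weak inequality `0 ≤ g` is the union of the cases `g = 0` and `0 < g`, so weak inequalities
add nothing to finite unions of such sets.) -/
def IsBasicSemialgebraic {ι : Type*} (S : Set (ι → ℝ)) : Prop :=
  ∃ E P : Finset (MvPolynomial ι ℝ),
    S = {x | (∀ f ∈ E, MvPolynomial.eval x f = 0) ∧ ∀ g ∈ P, 0 < MvPolynomial.eval x g}

/-- A semi-algebraic set: a finite union of basic ones. -/
def IsSemialgebraic {ι : Type*} (S : Set (ι → ℝ)) : Prop :=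
  ∃ F : Set (Set (ι → ℝ)), F.Finite ∧ (∀ B ∈ F, IsBasicSemialgebraic B) ∧ S = ⋃₀ F

/-- The dimension of a semi-algebraic set `S ⊆ ℝ^ι`: the Krull dimension of the ring of polynomial
functions on `S`, that is, of the polynomial ring modulo the ideal of the polynomials that vanish
on `S`. It is `⊥` for the empty set. -/
noncomputable def semialgebraicDim {ι : Type*} (S : Set (ι → ℝ)) : WithBot ℕ∞ :=
  ringKrullDim (MvPolynomial ι ℝ ⧸ MvPolynomial.vanishingIdeal ℝ S)

/-- A set of `m × n` matrices as a set of points in the coordinate space `ℝ^(m × n)`. -/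
def entrySet {m n : ℕ} (S : Set (Matrix (Fin m) (Fin n) ℝ)) : Set (Fin m × Fin n → ℝ) :=
  (fun (V : Matrix (Fin m) (Fin n) ℝ) (p : Fin m × Fin n) => V p.1 p.2) '' S

end LCN

/-! Encode a filter as a polynomial. Composing convolutions multiplies these polynomials, the later
one taken at a power of `X`. So by `exists_factorization` every end-to-end filter is `p * q(X ^
s')`, where `q` is the last filter, of length `k_L`, while `s'` is the stride of the network without
its last layer and `p` has the end-to-end length `a` of that network. Up to scaling there are `a +
(k_L - 1)` parameters, but ambient filters have `a + (k_L - 1) * s'` coefficients. As `k_L > 1` and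
`s' > 1`, the second number is larger, and the coefficients obey a nonzero polynomial relation
(`exists_relation`). Dividing a polynomial ring by a nonzero element lowers its Krull dimension
(`semialgebraicDim_lt`), and a set of smaller dimension cannot fill the ambient space.

The function space is the image of a polynomial map, so semi-algebraicity is Tarski-Seidenberg
(`isSemialgebraic_range`). In one variable, by Thom's lemma, each sign vector of a family closed
under derivatives occurs on a convex set; `determined_of_finite` shows that the signs of finitely
many elements of the coefficient ring decide which sign vectors occur. Parameter points are ring
homomorphisms `R →+* ℝ`, so that variables can be eliminated one at a time. -/

namespace TarskiSeidenberg

open Polynomial Set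

/-! ### Signs of one real polynomial: Thom's lemma -/

section OneVariable

lemma monotoneOn_eval (p : ℝ[X]) {a b : ℝ} (h : ∀ c ∈ Icc a b, 0 ≤ p.derivative.eval c) :
    MonotoneOn (fun t => p.eval t) (Icc a b) := by
  apply monotoneOn_of_deriv_nonneg (convex_Icc a b) p.continuous.continuousOn
    p.differentiable.differentiableOn
  intro c hc
  rw [Polynomial.deriv]
  exact h c (interior_subset hc)

lemma antitoneOn_eval (p : ℝ[X]) {a b : ℝ} (h : ∀ c ∈ Icc a b, p.derivative.eval c ≤ 0) :
    AntitoneOn (fun t => p.eval t) (Icc a b) := by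
  apply antitoneOn_of_deriv_nonpos (convex_Icc a b) p.continuous.continuousOn
    p.differentiable.differentiableOn
  intro c hc
  rw [Polynomial.deriv]
  exact h c (interior_subset hc)

lemma sign_nonneg_congr {a b : ℝ} (h : SignType.sign a = SignType.sign b) (ha : 0 ≤ a) :
    0 ≤ b := by
  rw [← sign_nonneg_iff] at ha ⊢
  rwa [← h]

lemma sign_nonpos_congr {a b : ℝ} (h : SignType.sign a = SignType.sign b) (ha : a ≤ 0) :
    b ≤ 0 := by
  rw [← sign_nonpos_iff] at ha ⊢
  rwa [← h]

/-- Thom's lemma: if all derivatives of a polynomial have the same signs at two points, then the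
polynomial has constant sign between them. -/
lemma thom (p : ℝ[X]) {a b : ℝ}
    (h : ∀ j, SignType.sign ((derivative^[j] p).eval a) =
      SignType.sign ((derivative^[j] p).eval b)) :
    ∀ c ∈ Icc a b, SignType.sign (p.eval c) = SignType.sign (p.eval a) := by
  induction hn : p.natDegree using Nat.strong_induction_on generalizing p with
  | _ n ih =>
    rcases Nat.eq_zero_or_pos n with h0 | h0
    · rw [Polynomial.eq_C_of_natDegree_eq_zero (hn.trans h0)]
      simp
    -- By induction the derivative has constant sign on the interval, so `p` is monotone and its
    -- values lie between two end values of equal sign.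
    · have ih' := ih _ (hn ▸ natDegree_derivative_lt (by omega)) (derivative p)
        (fun j => by simpa only [← Function.iterate_succ_apply] using h (j + 1)) rfl
      intro c hc
      have hab : a ≤ b := hc.1.trans hc.2
      have h0' := h 0
      simp only [Function.iterate_zero, id] at h0'
      rcases le_total 0 (p.derivative.eval a) with hs | hs
      · have hm := monotoneOn_eval p (fun c hc => sign_nonneg_congr (ih' c hc).symm hs)
        apply le_antisymm
        · rw [h0']
          exact SignType.sign.monotone (hm hc (right_mem_Icc.2 hab) hc.2)
        · exact SignType.sign.monotone (hm (left_mem_Icc.2 hab) hc hc.1)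
      · have hm := antitoneOn_eval p (fun c hc => sign_nonpos_congr (ih' c hc).symm hs)
        apply le_antisymm
        · exact SignType.sign.monotone (hm (left_mem_Icc.2 hab) hc hc.1)
        · rw [h0']
          exact SignType.sign.monotone (hm hc (right_mem_Icc.2 hab) hc.2)

end OneVariable

/-! ### Sign cells of a family of polynomials and their order -/

variable {R : Type*} [CommRing R]

/-- The signs at `t` of the members of a family of polynomials, specialized at `x`. -/
noncomputable def signVec (F : Set R[X]) (x : R →+* ℝ) (t : ℝ) : F → SignType :=
  fun f => SignType.sign ((f.1.map x).eval t)

lemma signVec_eq_iff {F : Set R[X]} {x y : R →+* ℝ} {t u : ℝ} :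
    signVec F x t = signVec F y u ↔
      ∀ f ∈ F, SignType.sign ((f.map x).eval t) = SignType.sign ((f.map y).eval u) := by
  simp [funext_iff, signVec]

lemma signVec_mono {F G : Set R[X]} (hFG : F ⊆ G) {x y : R →+* ℝ} {t u : ℝ}
    (h : signVec G x t = signVec G y u) : signVec F x t = signVec F y u :=
  signVec_eq_iff.2 fun f hf => signVec_eq_iff.1 h f (hFG hf)

/-- A family of polynomials that contains the derivatives of its members. -/
def DerivClosed (F : Set R[X]) : Prop := ∀ f ∈ F, derivative f ∈ F

lemma DerivClosed.iterate {F : Set R[X]} (hF : DerivClosed F) {f : R[X]} (hf : f ∈ F) (j : ℕ) :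
    derivative^[j] f ∈ F := by
  induction j with
  | zero => exact hf
  | succ j ih => rw [Function.iterate_succ_apply']; exact hF _ ih

lemma DerivClosed.signVec_eq_of_mem_Icc {F : Set R[X]} (hF : DerivClosed F) {x : R →+* ℝ}
    {a b c : ℝ} (h : signVec F x a = signVec F x b) (hc : c ∈ Icc a b) :
    signVec F x c = signVec F x a := by
  rw [signVec_eq_iff] at h ⊢
  intro f hf
  refine thom (f.map x) (fun j => ?_) c hc
  rw [iterate_derivative_map]
  exact h _ (hF.iterate hf j)

/-- Take `f` of least degree whose signs at `t` and `t'` differ. All members of lower degree agree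
there, so Thom's lemma fixes the sign of the derivative of `f` between the points, over `x` and over
`y` alike. Hence `f` is monotone in the same direction on both lines, and the order of the cells can
be read off its signs. -/
lemma DerivClosed.lt_of_lt {F : Set R[X]} (hF : DerivClosed F) {x y : R →+* ℝ}
    {t u t' u' : ℝ} (h : signVec F x t = signVec F y u) (h' : signVec F x t' = signVec F y u')
    (hne : signVec F x t ≠ signVec F x t') (htt' : t < t') : u < u' := by
  classical
  have hex : ∃ n, ∃ f ∈ F, f.natDegree = n ∧
      SignType.sign ((f.map x).eval t) ≠ SignType.sign ((f.map x).eval t') := by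
    by_contra! hcon
    exact hne (signVec_eq_iff.2 fun f hf => hcon _ f hf rfl)
  obtain ⟨f, hf, hdeg, hsf⟩ := Nat.find_spec hex
  have hmin : ∀ g ∈ F, g.natDegree < f.natDegree →
      SignType.sign ((g.map x).eval t) = SignType.sign ((g.map x).eval t') := by
    intro g hg hlt
    by_contra hcon
    exact Nat.find_min hex (hdeg ▸ hlt) ⟨g, hg, rfl, hcon⟩
  have hpos : f.natDegree ≠ 0 := by
    intro h0
    rw [Polynomial.eq_C_of_natDegree_eq_zero h0] at hsf
    simp at hsf
  set G : Set R[X] := {g ∈ F | g.natDegree < f.natDegree} with hG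
  have hGF : G ⊆ F := fun g hg => hg.1
  have hGc : DerivClosed G := fun g hg =>
    ⟨hF _ hg.1, (natDegree_derivative_le g).trans_lt (by have := hg.2; omega)⟩
  have hfG : derivative f ∈ G := ⟨hF _ hf, natDegree_derivative_lt hpos⟩
  have hGt : signVec G x t = signVec G x t' := signVec_eq_iff.2 fun g hg => hmin g hg.1 hg.2
  have hGu : signVec G y u' = signVec G y u := by
    rw [← signVec_mono hGF h, ← signVec_mono hGF h', hGt]
  have hx : ∀ c ∈ Icc t t', SignType.sign ((f.map x).derivative.eval c) =
      SignType.sign ((f.map x).derivative.eval t) := fun c hc => by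
    rw [derivative_map]
    exact signVec_eq_iff.1 (hGc.signVec_eq_of_mem_Icc hGt hc) _ hfG
  have hy : ∀ c ∈ Icc u' u, SignType.sign ((f.map y).derivative.eval c) =
      SignType.sign ((f.map x).derivative.eval t) := fun c hc => by
    rw [derivative_map, derivative_map]
    rw [signVec_eq_iff.1 (hGc.signVec_eq_of_mem_Icc hGu hc) _ hfG,
      signVec_eq_iff.1 hGu _ hfG, signVec_eq_iff.1 h _ (hF _ hf)]
  have e := signVec_eq_iff.1 h _ hf
  have e' := signVec_eq_iff.1 h' _ hf
  by_contra! hcon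
  rcases le_total 0 ((f.map x).derivative.eval t) with hs | hs
  · have m := monotoneOn_eval _ (fun c hc => sign_nonneg_congr (hx c hc).symm hs)
      (left_mem_Icc.2 htt'.le) (right_mem_Icc.2 htt'.le) htt'.le
    have m' := monotoneOn_eval _ (fun c hc => sign_nonneg_congr (hy c hc).symm hs)
      (left_mem_Icc.2 hcon) (right_mem_Icc.2 hcon) hcon
    exact hsf (le_antisymm (SignType.sign.monotone m)
      (by rw [e, e']; exact SignType.sign.monotone m'))
  · have m := antitoneOn_eval _ (fun c hc => sign_nonpos_congr (hx c hc).symm hs)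
      (left_mem_Icc.2 htt'.le) (right_mem_Icc.2 htt'.le) htt'.le
    have m' := antitoneOn_eval _ (fun c hc => sign_nonpos_congr (hy c hc).symm hs)
      (left_mem_Icc.2 hcon) (right_mem_Icc.2 hcon) hcon
    exact hsf (le_antisymm (by rw [e, e']; exact SignType.sign.monotone m')
      (SignType.sign.monotone m))

/-- Two labellings of the line by cells with matching order of cells: if a function increasing on
the first cell `s` takes a negative value there, so does its counterpart on the second one. -/
lemma exists_neg_of_neg {S : Type*} {σ τ : ℝ → S} {s : S} {f g : ℝ → ℝ}
    (hτ : ∀ {a b c}, τ a = τ b → c ∈ Icc a b → τ c = τ a)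
    (hord : ∀ {t u t' u'}, σ t = τ u → σ t' = τ u' → σ t ≠ σ t' → t < t' → u < u')
    (hστ : ∀ a, ∃ b, τ b = σ a)
    (hopen : IsOpen {u | τ u = s})
    (hend : ∀ b, τ b ≠ s → b ∈ closure {u | τ u = s} →
      ∃ a, σ a = τ b ∧ (∀ c, σ c = σ a → c = a) ∧ SignType.sign (f a) = SignType.sign (g b))
    (hg : Continuous g)
    (hf : ∀ a b, a < b → (∀ c ∈ Ioo a b, σ c = s) → f a < f b)
    (hinf : ∀ b, (∀ u ≤ b, τ u = s) → ∃ u ≤ b, g u < 0)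
    {t : ℝ} (ht : σ t = s) (hneg : f t < 0) : ∃ u, τ u = s ∧ g u < 0 := by
  by_contra! hcon
  obtain ⟨t', ht'⟩ := hστ t
  rw [ht] at ht'
  by_cases hbdd : BddBelow {u | τ u = s}
  -- If `g` were nonnegative on its cell, it would be so at the left end `b`. The partner `a` of `b`
  -- then has `f a ≥ 0`, and growth of `f` from `a` to `t` contradicts `f t < 0`.
  · set b := sInf {u | τ u = s} with hb
    have hbcl : b ∈ closure {u | τ u = s} := csInf_mem_closure ⟨t', ht'⟩ hbdd
    have hbs : τ b ≠ s := by
      intro hbs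
      obtain ⟨ε, hε, hball⟩ := Metric.isOpen_iff.1 hopen b hbs
      have h1 : b - ε / 2 ∈ Metric.ball b ε := by
        rw [Metric.mem_ball, Real.dist_eq, abs_lt]; constructor <;> linarith
      have := csInf_le hbdd (hball h1)
      linarith
    obtain ⟨a, hab, hsing, hsgn⟩ := hend b hbs hbcl
    have hgb : 0 ≤ g b := by
      have : closure {u | τ u = s} ⊆ {u | 0 ≤ g u} :=
        closure_minimal (fun u hu => hcon u hu) (isClosed_le continuous_const hg)
      exact this hbcl
    have hfa : 0 ≤ f a := sign_nonneg_congr hsgn.symm hgb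
    have hσne : σ a ≠ σ t := by rw [hab, ht]; exact hbs
    have hbt : b ≤ t' := csInf_le hbdd ht'
    have hat : a < t := by
      rcases lt_trichotomy a t with h | h | h
      · exact h
      · exact absurd (congrArg σ h) hσne
      · have := hord (ht.trans ht'.symm) hab hσne.symm h
        exact absurd hbt (not_le.2 this)
    -- A foreign cell between `a` and `t` would have a partner between `b` and `t'`, where only the
    -- cell `s` lives.
    have hcell : ∀ c ∈ Ioo a t, σ c = s := by
      intro c hc
      by_contra hcs
      obtain ⟨c', hc'⟩ := hστ c
      have h1 : b < c' := hord hab hc'.symm (fun h => hc.1.ne' (hsing c h.symm)) hc.1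
      have h2 : c' < t' := hord hc'.symm (ht.trans ht'.symm) (by rw [ht]; exact hcs) hc.2
      obtain ⟨u, hu, huc⟩ := exists_lt_of_csInf_lt ⟨t', ht'⟩ h1
      have h3 := hτ (show τ u = τ t' from Eq.trans hu ht'.symm) (c := c') ⟨huc.le, h2.le⟩
      exact hcs (hc'.symm.trans (h3.trans hu))
    linarith [hf a t hat hcell]
  · have hall : ∀ u ≤ t', τ u = s := by
      intro u hu
      obtain ⟨v, hv, hvu⟩ := not_bddBelow_iff.1 hbdd u
      have := hτ (show τ v = τ t' from Eq.trans hv ht'.symm) (c := u) ⟨hvu.le, hu⟩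
      exact this.trans hv
    obtain ⟨u, hu, hgu⟩ := hinf t' hall
    exact absurd hgu (not_lt.2 (hcon u (hall u hu)))

lemma isOpen_setOf_sign_eq {g : ℝ → ℝ} (hg : Continuous g) {s : SignType} (hs : s ≠ 0) :
    IsOpen {u | SignType.sign (g u) = s} := by
  cases s with
  | zero => exact absurd rfl hs
  | neg =>
    have : {u | SignType.sign (g u) = SignType.neg} = {u | g u < 0} := by
      ext u; exact sign_eq_neg_one_iff
    rw [this]
    exact isOpen_lt hg continuous_const
  | pos =>
    have : {u | SignType.sign (g u) = SignType.pos} = {u | 0 < g u} := by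
      ext u; exact sign_eq_one_iff
    rw [this]
    exact isOpen_lt continuous_const hg

lemma isOpen_cell {F : Set R[X]} (hfin : F.Finite) {y : R →+* ℝ} {v : ℝ}
    (hv : ∀ g ∈ F, g.map y ≠ 0 → (g.map y).eval v ≠ 0) :
    IsOpen {u | signVec F y u = signVec F y v} := by
  have : {u | signVec F y u = signVec F y v} = ⋂ g ∈ F,
      {u | SignType.sign ((g.map y).eval u) = SignType.sign ((g.map y).eval v)} := by
    ext u; simp [signVec_eq_iff]
  rw [this]
  refine hfin.isOpen_biInter fun g hg => ?_
  by_cases h0 : g.map y = 0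
  · simp [h0]
  · exact isOpen_setOf_sign_eq (g.map y).continuous (by rw [sign_ne_zero]; exact hv g hg h0)

/-- Nonzero signs at `b` persist nearby, hence at points of the cell. Without a root at `b`, the
point would itself lie in the cell. -/
lemma exists_root_of_mem_closure_cell {F : Set R[X]} {y : R →+* ℝ} {v b : ℝ}
    (hb : signVec F y b ≠ signVec F y v)
    (hcl : b ∈ closure {u | signVec F y u = signVec F y v}) :
    ∃ g ∈ F, g.map y ≠ 0 ∧ (g.map y).eval b = 0 := by
  by_contra! hcon
  apply hb
  rw [signVec_eq_iff]
  intro g hg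
  by_cases h0 : g.map y = 0
  · simp [h0]
  · have hop := isOpen_setOf_sign_eq (g.map y).continuous
      (s := SignType.sign ((g.map y).eval b)) (by rw [sign_ne_zero]; exact hcon g hg h0)
    obtain ⟨u, hu, hu'⟩ := mem_closure_iff.1 hcl _ hop rfl
    exact hu.symm.trans (signVec_eq_iff.1 hu' g hg)

/-- Two points in the cell of a root would, by Thom's lemma, make `g` vanish on a whole interval. -/
lemma DerivClosed.eq_of_root {F : Set R[X]} (hF : DerivClosed F) {x : R →+* ℝ} {g : R[X]}
    (hg : g ∈ F) (h0 : g.map x ≠ 0) {a c : ℝ} (ha : (g.map x).eval a = 0)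
    (hac : signVec F x c = signVec F x a) : c = a := by
  have key : ∀ {a c : ℝ}, (g.map x).eval a = 0 → signVec F x c = signVec F x a → ¬ a < c := by
    intro a c ha hac hlt
    apply h0
    apply Polynomial.eq_zero_of_infinite_isRoot
    refine (Icc_infinite hlt).mono fun d hd => ?_
    have := signVec_eq_iff.1 (hF.signVec_eq_of_mem_Icc hac.symm hd) g hg
    rwa [ha, sign_zero, sign_eq_zero_iff] at this
  have hc : (g.map x).eval c = 0 := by
    have := signVec_eq_iff.1 hac g hg
    rwa [ha, sign_zero, sign_eq_zero_iff] at this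
  exact le_antisymm (not_lt.1 (key ha hac)) (not_lt.1 (key hc hac.symm))

/-- An increasing polynomial that stays nonnegative towards `-∞` is bounded there, hence constant.
This handles cells without a left end. -/
lemma exists_neg_of_derivative_pos_Iic (p : ℝ[X]) (b : ℝ)
    (h : ∀ u ≤ b, 0 < p.derivative.eval u) : ∃ u ≤ b, p.eval u < 0 := by
  by_contra! hcon
  have hle : ∀ u ≤ b, p.eval u ≤ p.eval b := fun u hu =>
    monotoneOn_eval p (fun c hc => (h c hc.2).le) (left_mem_Icc.2 hu) (right_mem_Icc.2 hu) hu
  have hbd : Filter.IsBoundedUnder (· ≤ ·) Filter.atTop fun u => |(p.comp (-X)).eval u| := by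
    refine ⟨p.eval b, ?_⟩
    rw [Filter.eventually_map]
    filter_upwards [Filter.eventually_ge_atTop (-b)] with u hu
    have hu' : -u ≤ b := by linarith
    simp only [eval_comp, eval_neg, eval_X]
    rw [abs_of_nonneg (hcon _ hu')]
    exact hle _ hu'
  rw [Polynomial.isBoundedUnder_abs_atTop_iff, ← natDegree_eq_zero_iff_degree_le_zero,
    natDegree_comp, natDegree_neg, natDegree_X, mul_one] at hbd
  have := h b le_rfl
  rw [Polynomial.eq_C_of_natDegree_eq_zero hbd] at this
  simp at this

/-! ### Transferring the sign of a further polynomial between matching cells -/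

section Step

variable {F : Set R[X]} {x y : R →+* ℝ} {f : R[X]} {t : ℝ}

/-- This reduces to `exists_neg_of_neg`: `ε` selects the sign sought for `f`, and `δ` reverses the
line if needed, making `ε * f (δ * ·)` increasing on the cell. Finite ends of cells are roots, where
`hyx` controls the sign of `f`. -/
lemma exists_side (hfin : F.Finite) (hF : DerivClosed F)
    (hxy : ∀ a, ∃ b, signVec F y b = signVec F x a)
    (hyx : ∀ b, (∃ g ∈ F, g.map y ≠ 0 ∧ (g.map y).eval b = 0) → ∃ a,
      signVec F x a = signVec F y b ∧
      SignType.sign ((f.map x).eval a) = SignType.sign ((f.map y).eval b))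
    (hnz : ∀ g ∈ F, g.map x = 0 ↔ g.map y = 0)
    (hf' : derivative f ∈ F)
    (ht : ∀ g ∈ F, g.map x ≠ 0 → (g.map x).eval t ≠ 0)
    {ε δ : ℝ} (hδ : δ = 1 ∨ δ = -1)
    (hd : 0 < ε * δ * (f.map x).derivative.eval t) (hneg : ε * (f.map x).eval t < 0) :
    ∃ u, signVec F y u = signVec F x t ∧ ε * (f.map y).eval u < 0 := by
  have hδδ : ∀ a : ℝ, δ * (δ * a) = a := fun a => by rcases hδ with rfl | rfl <;> ring
  have hεs : ∀ a b : ℝ, SignType.sign a = SignType.sign b →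
      SignType.sign (ε * a) = SignType.sign (ε * b) := fun a b h => by rw [sign_mul, sign_mul, h]
  have hcontδ : Continuous fun u : ℝ => δ * u := continuous_const.mul continuous_id
  obtain ⟨v, hv⟩ := hxy t
  have hvroot : ∀ g ∈ F, g.map y ≠ 0 → (g.map y).eval v ≠ 0 := by
    intro g hg h0
    have := signVec_eq_iff.1 hv g hg
    rw [← sign_ne_zero, this, sign_ne_zero]
    exact ht g hg (fun h => h0 ((hnz g hg).1 h))
  have hcc : ∀ {z : R →+* ℝ} {a b c : ℝ}, signVec F z (δ * a) = signVec F z (δ * b) →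
      c ∈ Icc a b → signVec F z (δ * c) = signVec F z (δ * a) := by
    intro z a b c h hc
    rcases hδ with rfl | rfl
    · simp only [one_mul] at h ⊢
      exact hF.signVec_eq_of_mem_Icc h hc
    · rw [h]
      exact hF.signVec_eq_of_mem_Icc h.symm ⟨by linarith [hc.2], by linarith [hc.1]⟩
  have hder : ∀ (z : R →+* ℝ) (c : ℝ),
      (C ε * (f.map z).comp (C δ * X)).derivative.eval c =
        ε * δ * (f.map z).derivative.eval (δ * c) := by
    intro z c
    simp [derivative_comp, mul_assoc]
  have hsd : ∀ (z : R →+* ℝ) (c : ℝ), signVec F z (δ * c) = signVec F x t →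
      0 < (C ε * (f.map z).comp (C δ * X)).derivative.eval c := by
    intro z c hc
    rw [hder]
    have h1 := signVec_eq_iff.1 hc _ hf'
    rw [← derivative_map, ← derivative_map] at h1
    rw [← sign_eq_one_iff] at hd ⊢
    rw [sign_mul] at hd ⊢
    rw [h1, hd]
  obtain ⟨u, hu, hgu⟩ := exists_neg_of_neg (σ := fun a => signVec F x (δ * a))
    (τ := fun a => signVec F y (δ * a)) (s := signVec F x t)
    (f := fun a => ε * (f.map x).eval (δ * a)) (g := fun a => ε * (f.map y).eval (δ * a))
    (t := δ * t) hcc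
    (by
      intro t u t' u' h h' hne hlt
      rcases hδ with rfl | rfl
      · simp only [one_mul] at h h' hne
        exact hF.lt_of_lt h h' hne hlt
      · have := hF.lt_of_lt h' h hne.symm (by linarith)
        linarith)
    (fun a => by
      obtain ⟨b, hb⟩ := hxy (δ * a)
      exact ⟨δ * b, by simpa only [hδδ] using hb⟩)
    (by
      rw [← hv]
      exact (isOpen_cell hfin hvroot).preimage hcontδ)
    (by
      intro b hb hcl
      rw [← hv] at hb hcl
      have hcl' : δ * b ∈ closure {u | signVec F y u = signVec F y v} :=
        closure_mono (image_subset_iff.2 fun u hu => hu)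
          (image_closure_subset_closure_image hcontδ (mem_image_of_mem _ hcl))
      obtain ⟨g, hg, h0, hr⟩ := exists_root_of_mem_closure_cell hb hcl'
      obtain ⟨a, ha, hs⟩ := hyx (δ * b) ⟨g, hg, h0, hr⟩
      refine ⟨δ * a, by simpa only [hδδ] using ha, ?_, ?_⟩
      · intro c hc
        simp only [hδδ] at hc
        have hra : (g.map x).eval a = 0 := by
          have := signVec_eq_iff.1 ha g hg
          rwa [hr, sign_zero, sign_eq_zero_iff] at this
        have := hF.eq_of_root hg (fun h => h0 ((hnz g hg).1 h)) hra hc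
        rw [← this, hδδ]
      · simp only [hδδ]
        exact hεs _ _ hs)
    (continuous_const.mul ((f.map y).continuous.comp hcontδ))
    (by
      intro a b hab hc
      have := strictMonoOn_of_deriv_pos (convex_Icc a b)
        (C ε * (f.map x).comp (C δ * X)).continuous.continuousOn (by
          intro c hc'
          rw [interior_Icc] at hc'
          rw [Polynomial.deriv]
          exact hsd x c (hc c hc')) (left_mem_Icc.2 hab.le) (right_mem_Icc.2 hab.le) hab
      simpa using this)
    (by
      intro b hb
      obtain ⟨u, hu, h⟩ := exists_neg_of_derivative_pos_Iic
        (C ε * (f.map y).comp (C δ * X)) b (fun u hu => hsd y u (hb u hu))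
      exact ⟨u, hu, by simpa using h⟩)
    (by simp only [hδδ]) (by simpa only [hδδ] using hneg)
  exact ⟨δ * u, hu, hgu⟩

/-- A nonzero sign is transferred by `exists_side`. At a zero of `f` the derivative is nonzero, so
`f` takes both signs in the cell; both are transferred, and the intermediate value theorem gives a
zero in the convex partner cell. -/
lemma exists_match_of_open (hfin : F.Finite) (hF : DerivClosed F)
    (hxy : ∀ a, ∃ b, signVec F y b = signVec F x a)
    (hyx : ∀ b, (∃ g ∈ F, g.map y ≠ 0 ∧ (g.map y).eval b = 0) → ∃ a,
      signVec F x a = signVec F y b ∧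
      SignType.sign ((f.map x).eval a) = SignType.sign ((f.map y).eval b))
    (hnz : ∀ g ∈ F, g.map x = 0 ↔ g.map y = 0)
    (hf' : derivative f ∈ F) (hf0 : (derivative f).map x ≠ 0)
    (ht : ∀ g ∈ F, g.map x ≠ 0 → (g.map x).eval t ≠ 0) :
    ∃ u, signVec F y u = signVec F x t ∧
      SignType.sign ((f.map y).eval u) = SignType.sign ((f.map x).eval t) := by
  have hd0 : (f.map x).derivative.eval t ≠ 0 := by rw [derivative_map]; exact ht _ hf' hf0
  have side : ∀ ε : ℝ, ε = 1 ∨ ε = -1 → ∀ t', signVec F x t' = signVec F x t →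
      ε * (f.map x).eval t' < 0 →
      ∃ u, signVec F y u = signVec F x t ∧ ε * (f.map y).eval u < 0 := by
    intro ε hε t' ht' hneg
    have hroot' : ∀ g ∈ F, g.map x ≠ 0 → (g.map x).eval t' ≠ 0 := by
      intro g hg h0
      rw [← sign_ne_zero, signVec_eq_iff.1 ht' g hg, sign_ne_zero]
      exact ht g hg h0
    have hd0' : (f.map x).derivative.eval t' ≠ 0 := by
      rw [derivative_map]; exact hroot' _ hf' hf0
    have hε0 : ε ≠ 0 := by rcases hε with rfl | rfl <;> norm_num
    rw [← ht']
    rcases lt_or_gt_of_ne (mul_ne_zero hε0 hd0') with h | h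
    · exact exists_side hfin hF hxy hyx hnz hf' hroot' (.inr rfl) (by linarith) hneg
    · exact exists_side hfin hF hxy hyx hnz hf' hroot' (.inl rfl) (by linarith) hneg
  rcases lt_trichotomy ((f.map x).eval t) 0 with h | h | h
  · obtain ⟨u, hu, h'⟩ := side 1 (.inl rfl) t rfl (by linarith)
    exact ⟨u, hu, by rw [sign_neg h, sign_neg (by linarith)]⟩
  -- If one sign were missing, `t` would be a local extremum of `f`.
  · have hex : ∀ ε : ℝ, ε = 1 ∨ ε = -1 →
        ∃ t', signVec F x t' = signVec F x t ∧ ε * (f.map x).eval t' < 0 := by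
      intro ε hε
      by_contra! hcon
      have hmin : IsLocalMin (fun u => (C ε * f.map x).eval u) t := by
        filter_upwards [(isOpen_cell hfin ht).mem_nhds rfl] with u hu
        simpa [h] using hcon u hu
      have h2 := hmin.deriv_eq_zero
      rw [Polynomial.deriv] at h2
      rcases hε with rfl | rfl <;> simp at h2 <;> exact hd0 (by rw [derivative_map]; exact h2)
    obtain ⟨t₁, h₁, h₁'⟩ := hex 1 (.inl rfl)
    obtain ⟨t₂, h₂, h₂'⟩ := hex (-1) (.inr rfl)
    obtain ⟨u₁, g₁, g₁'⟩ := side 1 (.inl rfl) t₁ h₁ h₁'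
    obtain ⟨u₂, g₂, g₂'⟩ := side (-1) (.inr rfl) t₂ h₂ h₂'
    obtain ⟨u, hu, hu0⟩ := intermediate_value_uIcc (a := u₁) (b := u₂)
      (f.map y).continuous.continuousOn
      (show (0 : ℝ) ∈ uIcc _ _ from
        mem_uIcc.2 (.inl ⟨by linarith, by linarith⟩))
    refine ⟨u, ?_, by rw [h]; exact congrArg _ hu0⟩
    rcases mem_uIcc.1 hu with hu | hu
    · exact (hF.signVec_eq_of_mem_Icc (g₁.trans g₂.symm) hu).trans g₁
    · exact (hF.signVec_eq_of_mem_Icc (g₂.trans g₁.symm) hu).trans g₂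
  · obtain ⟨u, hu, h'⟩ := side (-1) (.inr rfl) t rfl (by linarith)
    exact ⟨u, hu, by rw [sign_pos h, sign_pos (by linarith)]⟩

end Step

/-! ### Pseudo-division -/

/-- The part of `g` of degree at most `j`. -/
noncomputable def truncLE (g : R[X]) (j : ℕ) : R[X] :=
  ∑ i ∈ Finset.range (j + 1), monomial i (g.coeff i)

lemma coeff_truncLE (g : R[X]) (j i : ℕ) :
    (truncLE g j).coeff i = if i ≤ j then g.coeff i else 0 := by
  simp [truncLE, coeff_monomial]

lemma map_truncLE {S : Type*} [CommRing S] (x : R →+* S) (g : R[X]) {j : ℕ}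
    (hj : (g.map x).natDegree ≤ j) : (truncLE g j).map x = g.map x := by
  ext i
  rw [coeff_map, coeff_truncLE]
  split_ifs with h
  · rw [coeff_map]
  · rw [map_zero, coeff_eq_zero_of_natDegree_lt (by omega)]

/-- The formal leading coefficient `g.coeff j` need not be invertible, so each cancellation of the
top term of `f` multiplies by it instead of dividing. -/
lemma exists_pseudo_div (g : R[X]) (j : ℕ) (hg : ∀ i, j < i → g.coeff i = 0) (N : ℕ) (f : R[X])
    (hf : ∀ i, N ≤ i → f.coeff i = 0) :
    ∃ (m : ℕ) (q r : R[X]), C (g.coeff j ^ m) * f = q * g + r ∧ ∀ i, j ≤ i → r.coeff i = 0 := by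
  induction N generalizing f with
  | zero => exact ⟨0, 0, f, by simp, fun i _ => hf i (Nat.zero_le i)⟩
  | succ N ih =>
    rcases lt_or_ge N j with h | h
    · exact ⟨0, 0, f, by simp, fun i hi => hf i (by omega)⟩
    · obtain ⟨m, q, r, hqr, hr⟩ := ih
        (C (g.coeff j) * f - C (f.coeff N) * (X ^ (N - j) * g)) (fun i hi => by
          rw [coeff_sub, coeff_C_mul, coeff_C_mul, coeff_X_pow_mul', if_pos (by omega)]
          rcases hi.eq_or_lt with rfl | hlt
          · rw [Nat.sub_sub_self h, mul_comm, sub_self]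
          · rw [hf i hlt, hg (i - (N - j)) (by omega), mul_zero, mul_zero, sub_zero])
      refine ⟨m + 1, q + C (g.coeff j ^ m) * C (f.coeff N) * X ^ (N - j), r, ?_, hr⟩
      rw [pow_succ, C_mul]
      linear_combination hqr

/-- The multiplier is made a square so that it is positive wherever `g.coeff j` specializes to a
nonzero number. -/
lemma exists_pseudo_remainder (f g : R[X]) (j : ℕ) :
    ∃ (m : ℕ) (q r : R[X]), C ((g.coeff j ^ m) ^ 2) * f = q * truncLE g j + r ∧
      ∀ i, j ≤ i → r.coeff i = 0 := by
  obtain ⟨m, q, r, h, hr⟩ := exists_pseudo_div (truncLE g j) j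
    (fun i hi => by rw [coeff_truncLE, if_neg (by omega)]) (f.natDegree + 1) f
    (fun i hi => coeff_eq_zero_of_natDegree_lt hi)
  rw [coeff_truncLE, if_pos le_rfl] at h
  refine ⟨m, C (g.coeff j ^ m) * q, C (g.coeff j ^ m) * r, ?_, fun i hi => ?_⟩
  · rw [pow_two, C_mul]
    linear_combination C (g.coeff j ^ m) * h
  · rw [coeff_C_mul, hr i hi, mul_zero]

/-- The remainder of a pseudo-division of `f` by the part of `g` of degree at most `j`. -/
noncomputable def pseudoRem (f g : R[X]) (j : ℕ) : R[X] :=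
  (exists_pseudo_remainder f g j).choose_spec.choose_spec.choose

lemma coeff_pseudoRem (f g : R[X]) {j i : ℕ} (h : j ≤ i) : (pseudoRem f g j).coeff i = 0 :=
  (exists_pseudo_remainder f g j).choose_spec.choose_spec.choose_spec.2 i h

/-- At a root of the specialized `g` the division identity reads `c ^ 2 * f = r`, with `c` a power
of its nonzero leading coefficient. -/
lemma sign_pseudoRem (f g : R[X]) {x : R →+* ℝ} {t : ℝ} (h0 : g.map x ≠ 0)
    (ht : (g.map x).eval t = 0) :
    SignType.sign (((pseudoRem f g (g.map x).natDegree).map x).eval t) =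
      SignType.sign ((f.map x).eval t) := by
  set j := (g.map x).natDegree with hj
  have h := (exists_pseudo_remainder f g j).choose_spec.choose_spec.choose_spec.1
  have h' := congrArg (fun p => (p.map x).eval t) h
  simp only [Polynomial.map_mul, Polynomial.map_add, eval_mul, eval_add, map_truncLE x g hj.ge,
    ht, mul_zero, zero_add, map_C, eval_C] at h'
  rw [pseudoRem, ← h', sign_mul, sign_pos, one_mul]
  rw [map_pow, map_pow]
  have : x (g.coeff j) ≠ 0 := by
    rw [← coeff_map]
    exact leadingCoeff_ne_zero.2 h0
  positivity

/-! ### Quantifier elimination -/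

/-- The signs of finitely many ring elements at a point determine which sign vectors the family
has over this point. -/
def Determined (F : Set R[X]) : Prop :=
  ∃ Q : Set R, Q.Finite ∧ ∀ x y : R →+* ℝ,
    (∀ q ∈ Q, SignType.sign (x q) = SignType.sign (y q)) →
    ∀ t, ∃ u, signVec F y u = signVec F x t

lemma Determined.mono {F G : Set R[X]} (hFG : F ⊆ G) (hG : Determined G) : Determined F := by
  obtain ⟨Q, hQ, h⟩ := hG
  refine ⟨Q, hQ, fun x y hxy t => ?_⟩
  obtain ⟨u, hu⟩ := h x y hxy t
  exact ⟨u, signVec_mono hFG hu⟩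

/-- The coefficients, as constant polynomials, of the members of a family. -/
def coeffSet (F : Set R[X]) : Set R[X] := ⋃ g ∈ F, (fun i => C (g.coeff i)) '' Iic (g.natDegree + 1)

lemma C_coeff_mem_coeffSet {F : Set R[X]} {g : R[X]} (hg : g ∈ F) (i : ℕ) :
    C (g.coeff i) ∈ coeffSet F := by
  simp only [coeffSet, mem_iUnion]
  refine ⟨g, hg, ?_⟩
  by_cases hi : i ≤ g.natDegree + 1
  · exact ⟨i, hi, rfl⟩
  -- The extra index contributes the zero coefficient, which stands for all higher ones.
  · refine ⟨g.natDegree + 1, mem_Iic.2 le_rfl, ?_⟩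
    simp only
    rw [coeff_eq_zero_of_natDegree_lt (Nat.lt_succ_self _),
      coeff_eq_zero_of_natDegree_lt (by omega)]

/-- The pseudo-remainders of `f` with respect to the truncations of the members of a family. -/
def remSet (F : Set R[X]) (f : R[X]) : Set R[X] :=
  ⋃ g ∈ F, (fun j => pseudoRem f g j) '' Iic g.natDegree

/-- Coefficients in `F'` make degrees and vanishing agree over `x` and `y`; pseudo-remainders in
`F'` give the sign of `f` at the roots of members of `F`. Away from these roots, `f` is either
constant or covered by `exists_match_of_open`. -/
lemma exists_match_insert {F F' : Set R[X]} {f : R[X]} (hfin : F.Finite) (hF : DerivClosed F)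
    (hf' : derivative f ∈ F) (hFF' : F ⊆ F') (hcoeff : coeffSet (insert f F) ⊆ F')
    (hrem : remSet F f ⊆ F') {x y : R →+* ℝ}
    (hxy : ∀ t, ∃ u, signVec F' y u = signVec F' x t)
    (hyx : ∀ t, ∃ u, signVec F' x u = signVec F' y t) (t : ℝ) :
    ∃ u, signVec (insert f F) y u = signVec (insert f F) x t := by
  have hsc : ∀ g ∈ insert f F, ∀ i,
      SignType.sign (x (g.coeff i)) = SignType.sign (y (g.coeff i)) := by
    intro g hg i
    obtain ⟨u, hu⟩ := hxy 0
    have := signVec_eq_iff.1 hu _ (hcoeff (C_coeff_mem_coeffSet hg i))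
    simpa using this.symm
  have hz : ∀ g ∈ insert f F, ∀ i, (g.map x).coeff i = 0 ↔ (g.map y).coeff i = 0 := by
    intro g hg i
    rw [coeff_map, coeff_map, ← sign_eq_zero_iff, hsc g hg i, sign_eq_zero_iff]
  have hnz : ∀ g ∈ insert f F, g.map x = 0 ↔ g.map y = 0 := by
    intro g hg
    simp only [Polynomial.ext_iff, coeff_zero, hz g hg]
  have hdeg : ∀ g ∈ insert f F, (g.map x).natDegree = (g.map y).natDegree := by
    intro g hg
    apply le_antisymm
    · rw [natDegree_le_iff_coeff_eq_zero]
      intro i hi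
      rw [hz g hg, coeff_eq_zero_of_natDegree_lt hi]
    · rw [natDegree_le_iff_coeff_eq_zero]
      intro i hi
      rw [← hz g hg, coeff_eq_zero_of_natDegree_lt hi]
  have hroot : ∀ a b, signVec F' x a = signVec F' y b →
      (∃ g ∈ F, g.map y ≠ 0 ∧ (g.map y).eval b = 0) →
      SignType.sign ((f.map x).eval a) = SignType.sign ((f.map y).eval b) := by
    rintro a b hab ⟨g, hg, h0, hr⟩
    have hg' : g ∈ insert f F := mem_insert_of_mem _ hg
    have hra : (g.map x).eval a = 0 := by
      have := signVec_eq_iff.1 hab g (hFF' hg)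
      rwa [hr, sign_zero, sign_eq_zero_iff] at this
    rw [← sign_pseudoRem f g h0 hr,
      ← sign_pseudoRem f g (fun h => h0 ((hnz g hg').1 h)) hra, hdeg g hg']
    refine signVec_eq_iff.1 hab _ (hrem ?_)
    simp only [remSet, mem_iUnion]
    exact ⟨g, hg, _, mem_Iic.2 natDegree_map_le, rfl⟩
  suffices ∃ u, signVec F y u = signVec F x t ∧
      SignType.sign ((f.map y).eval u) = SignType.sign ((f.map x).eval t) by
    obtain ⟨u, hu, h⟩ := this
    refine ⟨u, signVec_eq_iff.2 ?_⟩
    rintro g (rfl | hg)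
    · exact h
    · exact signVec_eq_iff.1 hu g hg
  by_cases hex : ∃ g ∈ F, g.map x ≠ 0 ∧ (g.map x).eval t = 0
  · obtain ⟨u, hu⟩ := hxy t
    refine ⟨u, signVec_mono hFF' hu, (hroot t u hu.symm ?_).symm⟩
    obtain ⟨g, hg, h0, hr⟩ := hex
    refine ⟨g, hg, fun h => h0 ((hnz g (mem_insert_of_mem _ hg)).2 h), ?_⟩
    have := signVec_eq_iff.1 hu g (hFF' hg)
    rwa [hr, sign_zero, sign_eq_zero_iff] at this
  · push Not at hex
    by_cases hf0 : (derivative f).map x = 0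
    · obtain ⟨u, hu⟩ := hxy t
      refine ⟨u, signVec_mono hFF' hu, ?_⟩
      have hcst : (f.map x).natDegree = 0 := by
        rw [← derivative_map] at hf0
        exact derivative_eq_zero.1 hf0
      have hcst' := hcst
      rw [hdeg f (mem_insert _ _)] at hcst'
      rw [eq_C_of_natDegree_eq_zero hcst, eq_C_of_natDegree_eq_zero hcst', eval_C, eval_C,
        coeff_map, coeff_map]
      exact (hsc f (mem_insert _ _) 0).symm
    · refine exists_match_of_open hfin hF (fun a => ?_) (fun b hb => ?_)
        (fun g hg => hnz g (mem_insert_of_mem _ hg)) hf' hf0 hex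
      · obtain ⟨u, hu⟩ := hxy a
        exact ⟨u, signVec_mono hFF' hu⟩
      · obtain ⟨a, ha⟩ := hyx b
        exact ⟨a, signVec_mono hFF' ha, hroot a b ha hb⟩

lemma finite_coeffSet {F : Set R[X]} (hF : F.Finite) : (coeffSet F).Finite :=
  hF.biUnion fun _ _ => (finite_Iic _).image _

lemma finite_remSet {F : Set R[X]} (hF : F.Finite) (f : R[X]) : (remSet F f).Finite :=
  hF.biUnion fun _ _ => (finite_Iic _).image _

lemma natDegree_of_mem_coeffSet {F : Set R[X]} {g : R[X]} (hg : g ∈ coeffSet F) :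
    g.natDegree = 0 := by
  simp only [coeffSet, mem_iUnion] at hg
  obtain ⟨h, -, i, -, rfl⟩ := hg
  exact natDegree_C _

lemma natDegree_of_mem_remSet {F : Set R[X]} {f g : R[X]} {n : ℕ}
    (hF : ∀ h ∈ F, h.natDegree ≤ n + 1) (hg : g ∈ remSet F f) : g.natDegree ≤ n := by
  simp only [remSet, mem_iUnion] at hg
  obtain ⟨h, hh, j, hj, rfl⟩ := hg
  rw [natDegree_le_iff_coeff_eq_zero]
  intro i hi
  exact coeff_pseudoRem f h (by have := hF h hh; have := mem_Iic.1 hj; omega)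

/-- The iterated derivatives of the members of a family. -/
def derivSet (F : Set R[X]) : Set R[X] := ⋃ g ∈ F, range fun i => derivative^[i] g

lemma subset_derivSet (F : Set R[X]) : F ⊆ derivSet F := fun g hg => by
  simp only [derivSet, mem_iUnion]
  exact ⟨g, hg, 0, rfl⟩

lemma derivClosed_derivSet (F : Set R[X]) : DerivClosed (derivSet F) := by
  intro g hg
  simp only [derivSet, mem_iUnion] at hg ⊢
  obtain ⟨h, hh, i, rfl⟩ := hg
  exact ⟨h, hh, i + 1, Function.iterate_succ_apply' _ _ _⟩

lemma finite_derivSet {F : Set R[X]} (hF : F.Finite) : (derivSet F).Finite := by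
  refine hF.biUnion fun g _ => ((finite_Iic (g.natDegree + 1)).image
    fun i => derivative^[i] g).subset ?_
  rintro _ ⟨i, rfl⟩
  by_cases hi : i ≤ g.natDegree + 1
  · exact ⟨i, hi, rfl⟩
  · refine ⟨g.natDegree + 1, mem_Iic.2 le_rfl, ?_⟩
    simp only
    rw [iterate_derivative_eq_zero (by omega), iterate_derivative_eq_zero (by omega)]

lemma natDegree_of_mem_derivSet {F : Set R[X]} {n : ℕ} (hF : ∀ h ∈ F, h.natDegree ≤ n + 1)
    {g : R[X]} (hg : g ∈ derivSet F) : g ∈ F ∨ g.natDegree ≤ n := by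
  simp only [derivSet, mem_iUnion] at hg
  obtain ⟨h, hh, i, rfl⟩ := hg
  rcases i with _ | i
  · exact .inl hh
  · right
    exact (natDegree_iterate_derivative h (i + 1)).trans (by have := hF h hh; omega)

/-- One-variable quantifier elimination over the reals. -/
theorem determined_of_finite {F : Set R[X]} (hF : F.Finite) : Determined F := by
  suffices ∀ n, ∀ F : Set R[X], F.Finite → (∀ f ∈ F, f.natDegree ≤ n) → Determined F by
    obtain ⟨n, hn⟩ := (hF.image natDegree).bddAbove
    exact this n F hF fun f hf => hn (mem_image_of_mem _ hf)
  intro n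
  induction n with
  | zero =>
    intro F hF hdeg
    refine ⟨(fun f => f.coeff 0) '' F, hF.image _, fun x y hxy t => ⟨t, ?_⟩⟩
    rw [signVec_eq_iff]
    intro f hf
    rw [eq_C_of_natDegree_eq_zero (Nat.le_zero.1 (hdeg f hf))]
    simpa using (hxy _ (mem_image_of_mem _ hf)).symm
  | succ n ih =>
    -- Inner induction on `T`, the members of degree up to `n + 1`. Removing one of them costs only
    -- derivatives, coefficients and pseudo-remainders, which lie in the rest of `T` or have degree
    -- at most `n`.
    have key : ∀ T : Set R[X], T.Finite → (∀ f ∈ T, f.natDegree ≤ n + 1) →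
        ∀ B : Set R[X], B.Finite → (∀ f ∈ B, f.natDegree ≤ n) → Determined (T ∪ B) := by
      intro T hT
      induction T, hT using Set.Finite.induction_on with
      | empty =>
        intro _ B hB hBd
        rw [empty_union]
        exact ih B hB hBd
      | @insert f T _ hT IH =>
        intro hTd B hB hBd
        have hTd' : ∀ g ∈ T, g.natDegree ≤ n + 1 := fun g hg => hTd g (mem_insert_of_mem _ hg)
        have hfd : (derivative f).natDegree ≤ n := by
          have := natDegree_derivative_le f
          have := hTd f (mem_insert _ _)
          omega
        set G : Set R[X] := T ∪ insert (derivative f) B with hG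
        have hGfin : G.Finite := hT.union (hB.insert _)
        have hGd : ∀ g ∈ G, g.natDegree ≤ n + 1 := by
          rintro g (hg | rfl | hg)
          · exact hTd' g hg
          · omega
          · have := hBd g hg; omega
        have hDd : ∀ g ∈ derivSet G, g ∈ T ∨ g.natDegree ≤ n := by
          intro g hg
          rcases natDegree_of_mem_derivSet hGd hg with (h | rfl | h) | h
          · exact .inl h
          · exact .inr hfd
          · exact .inr (hBd g h)
          · exact .inr h
        have hDd' : ∀ g ∈ derivSet G, g.natDegree ≤ n + 1 := fun g hg =>
          (hDd g hg).elim (hTd' g) (fun h => by omega)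
        have hDfin := finite_derivSet hGfin
        set E : Set R[X] :=
          derivSet G ∪ coeffSet (insert f (derivSet G)) ∪ remSet (derivSet G) f with hE
        have hEfin : E.Finite :=
          (hDfin.union (finite_coeffSet (hDfin.insert _))).union (finite_remSet hDfin f)
        obtain ⟨Q, hQ, hdet⟩ := IH hTd' (E \ T) (hEfin.subset sdiff_subset) (by
          rintro g ⟨(hg | hg) | hg, hgT⟩
          · exact (hDd g hg).resolve_left hgT
          · rw [natDegree_of_mem_coeffSet hg]; omega
          · exact natDegree_of_mem_remSet hDd' hg)
        rw [union_sdiff_self] at hdet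
        have hsub : insert f T ∪ B ⊆ insert f (derivSet G) := by
          rw [insert_union]
          refine insert_subset_insert ((union_subset_union_right _ ?_).trans (subset_derivSet G))
          exact subset_insert _ _
        refine Determined.mono hsub ⟨Q, hQ, fun x y hxy t => ?_⟩
        refine exists_match_insert (F' := T ∪ E) hDfin (derivClosed_derivSet G)
          (subset_derivSet G (.inr (mem_insert _ _)))
          (fun g hg => .inr (.inl (.inl hg))) (fun g hg => .inr (.inl (.inr hg)))
          (fun g hg => .inr (.inr hg)) (hdet x y hxy)
          (hdet y x fun q hq => (hxy q hq).symm) t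
    intro F hF hdeg
    have := key F hF hdeg ∅ finite_empty (by simp)
    rwa [union_empty] at this

/-- Quantifier elimination over the reals for a block of variables. -/
theorem exists_finite_determining (n : ℕ) {P : Set (MvPolynomial (Fin n) R)} (hP : P.Finite) :
    ∃ Q : Set R, Q.Finite ∧ ∀ x y : R →+* ℝ,
      (∀ q ∈ Q, SignType.sign (x q) = SignType.sign (y q)) →
      ∀ w : Fin n → ℝ, ∃ v : Fin n → ℝ, ∀ p ∈ P,
        SignType.sign (MvPolynomial.eval₂Hom y v p) =
          SignType.sign (MvPolynomial.eval₂Hom x w p) := by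
  induction n with
  | zero =>
    refine ⟨MvPolynomial.coeff 0 '' P, hP.image _,
      fun x y hxy w => ⟨w, fun p hp => ?_⟩⟩
    have := hxy _ (mem_image_of_mem _ hp)
    obtain ⟨c, rfl⟩ := MvPolynomial.C_surjective (Fin 0) p
    rw [MvPolynomial.coeff_zero_C] at this
    simpa using this.symm
  | succ n ih =>
    -- Variable `0` is eliminated over the polynomial ring in the others; the induction then treats
    -- the resulting conditions `Q₁`.
    obtain ⟨Q₁, hQ₁, h₁⟩ := determined_of_finite (hP.image (MvPolynomial.finSuccEquiv R n))
    obtain ⟨Q, hQ, h⟩ := ih hQ₁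
    refine ⟨Q, hQ, fun x y hxy w => ?_⟩
    obtain ⟨v, hv⟩ := h x y hxy (Fin.tail w)
    obtain ⟨u, hu⟩ := h₁ (MvPolynomial.eval₂Hom x (Fin.tail w)) (MvPolynomial.eval₂Hom y v)
      (fun q hq => (hv q hq).symm) (w 0)
    have key : ∀ (z : R →+* ℝ) (a : ℝ) (b : Fin n → ℝ) (p : MvPolynomial (Fin (n + 1)) R),
        ((MvPolynomial.finSuccEquiv R n p).map (MvPolynomial.eval₂Hom z b)).eval a =
          MvPolynomial.eval₂Hom z (Fin.cons a b : Fin (n + 1) → ℝ) p := by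
      intro z a b p
      have : ((Polynomial.evalRingHom a).comp (Polynomial.mapRingHom
          (MvPolynomial.eval₂Hom z b))).comp (MvPolynomial.finSuccEquiv R n : _ →+* _) =
          MvPolynomial.eval₂Hom z (Fin.cons a b : Fin (n + 1) → ℝ) := by
        apply MvPolynomial.ringHom_ext
        · intro r
          simp [MvPolynomial.finSuccEquiv_apply]
        · intro i
          refine Fin.cases ?_ (fun j => ?_) i <;> simp [MvPolynomial.finSuccEquiv_apply]
      exact RingHom.congr_fun this p
    refine ⟨Fin.cons u v, fun p hp => ?_⟩
    rw [← key, ← Fin.cons_self_tail w, ← key]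
    exact signVec_eq_iff.1 hu _ (mem_image_of_mem _ hp)

end TarskiSeidenberg

/-! ### Semi-algebraic sets and polynomial images -/

namespace TarskiSeidenberg

open Set

variable {ι κ : Type*}

/-- The set of points where the members of `Q` have prescribed signs. -/
def signCell (Q : Finset (MvPolynomial ι ℝ)) (s : Q → SignType) : Set (ι → ℝ) :=
  {x | ∀ q : Q, SignType.sign (MvPolynomial.eval x q.1) = s q}

lemma isBasicSemialgebraic_signCell (Q : Finset (MvPolynomial ι ℝ)) (s : Q → SignType) :
    LCN.IsBasicSemialgebraic (signCell Q s) := by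
  classical
  refine ⟨(Q.attach.filter fun q => s q = 0).image Subtype.val,
    (Q.attach.filter fun q => s q = 1).image Subtype.val ∪
      (Q.attach.filter fun q => s q = -1).image fun q => -q.1, ?_⟩
  ext x
  simp only [signCell, mem_ofPred_eq, Finset.mem_image, Finset.mem_filter, Finset.mem_attach,
    true_and, Finset.mem_union]
  constructor
  · intro h
    refine ⟨?_, ?_⟩
    · rintro _ ⟨q, hq, rfl⟩
      rw [← sign_eq_zero_iff, h q, hq]
    · rintro _ (⟨q, hq, rfl⟩ | ⟨q, hq, rfl⟩)
      · rw [← sign_eq_one_iff, h q, hq]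
      · rw [map_neg, neg_pos, ← sign_eq_neg_one_iff, h q, hq]
  · rintro ⟨hE, hP⟩ q
    rcases hs : s q with _ | _ | _
    · exact sign_eq_zero_iff.2 (hE _ ⟨q, hs, rfl⟩)
    · have := hP _ (.inr ⟨q, hs, rfl⟩)
      rw [map_neg, neg_pos] at this
      exact sign_eq_neg_one_iff.2 this
    · exact sign_eq_one_iff.2 (hP _ (.inl ⟨q, hs, rfl⟩))

/-- The set is the union of the sign cells that it meets, and there are finitely many cells. -/
lemma isSemialgebraic_of_signs {S : Set (ι → ℝ)} {Q : Set (MvPolynomial ι ℝ)} (hQ : Q.Finite)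
    (h : ∀ x y : ι → ℝ, (∀ q ∈ Q, SignType.sign (MvPolynomial.eval x q) =
      SignType.sign (MvPolynomial.eval y q)) → x ∈ S → y ∈ S) : LCN.IsSemialgebraic S := by
  refine ⟨signCell hQ.toFinset '' {s | (signCell hQ.toFinset s ∩ S).Nonempty},
    (toFinite _).image _, ?_, ?_⟩
  · rintro _ ⟨s, -, rfl⟩
    exact isBasicSemialgebraic_signCell _ _
  · ext y
    simp only [sUnion_image, mem_iUnion, mem_ofPred_eq, exists_prop]
    constructor
    · intro hy
      exact ⟨fun q => SignType.sign (MvPolynomial.eval y q.1), ⟨y, fun q => rfl, hy⟩, fun q => rfl⟩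
    · rintro ⟨s, ⟨x, hx, hxS⟩, hy⟩
      refine h x y (fun q hq => ?_) hxS
      have hq' : q ∈ hQ.toFinset := hQ.mem_toFinset.2 hq
      exact (hx ⟨q, hq'⟩).trans (hy ⟨q, hq'⟩).symm

/-- The image of a polynomial map is semi-algebraic. -/
theorem isSemialgebraic_range [Finite ι] [Finite κ] (φ : ι → MvPolynomial κ ℝ) :
    LCN.IsSemialgebraic (range fun (w : κ → ℝ) (i : ι) => MvPolynomial.eval w (φ i)) := by
  obtain ⟨n, ⟨e⟩⟩ := Finite.exists_equiv_fin κ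
  -- The image is the projection of the common zeros of `x i - φ i (w)`, with the coordinates `x` as
  -- coefficients and `w` to be eliminated.
  let p : ι → MvPolynomial (Fin n) (MvPolynomial ι ℝ) := fun i =>
    MvPolynomial.C (MvPolynomial.X i) -
      MvPolynomial.map MvPolynomial.C (MvPolynomial.rename e (φ i))
  have hp : ∀ (x : ι → ℝ) (w : Fin n → ℝ) (i : ι),
      MvPolynomial.eval₂Hom (MvPolynomial.eval x) w (p i) =
        x i - MvPolynomial.eval (w ∘ e) (φ i) := by
    intro x w i
    have hc : (MvPolynomial.eval x).comp (MvPolynomial.C : ℝ →+* MvPolynomial ι ℝ) =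
        RingHom.id ℝ := by ext r; simp
    simp only [p, map_sub, MvPolynomial.coe_eval₂Hom, MvPolynomial.eval₂_C, MvPolynomial.eval_X,
      MvPolynomial.eval₂_map, hc, MvPolynomial.eval₂_rename]
    rfl
  obtain ⟨Q, hQ, h⟩ := exists_finite_determining n (finite_range p)
  refine isSemialgebraic_of_signs hQ ?_
  rintro x y hxy ⟨w, rfl⟩
  obtain ⟨v, hv⟩ := h _ _ hxy (w ∘ e.symm)
  refine ⟨v ∘ e, funext fun i => ?_⟩
  have := hv _ (mem_range_self i)
  rw [hp, hp] at this
  have hw : (w ∘ e.symm) ∘ e = w := by ext; simp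
  rw [hw, sub_self, sign_zero, sign_eq_zero_iff, sub_eq_zero] at this
  exact this.symm

end TarskiSeidenberg

/-! ### Convolutional matrices as polynomials -/

namespace LCN

open Polynomial

/-- The `m × n` convolutional matrix of stride `s` whose filter is the coefficient sequence
of `p`. -/
noncomputable def toeplitz (m n s : ℕ) (p : ℝ[X]) : Matrix (Fin m) (Fin n) ℝ :=
  Matrix.of fun i t => (X ^ ((i : ℕ) * s) * p).coeff t

/-- The polynomial with coefficient sequence `w`. -/
noncomputable def filterPoly {k : ℕ} (w : Fin k → ℝ) : ℝ[X] := ∑ j : Fin k, monomial (j : ℕ) (w j)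

lemma convMatrix_eq_toeplitz (m n k s : ℕ) (w : Fin k → ℝ) :
    convMatrix m n k s w = toeplitz m n s (filterPoly w) := by
  ext i t
  simp only [convMatrix, toeplitz, filterPoly, Matrix.of_apply, Finset.mul_sum, finsetSum_coeff]
  refine Finset.sum_congr rfl fun j _ => ?_
  rw [X_pow_mul_monomial, coeff_monomial]
  refine if_congr ⟨fun h => ?_, fun h => ?_⟩ rfl rfl <;> omega

lemma natDegree_filterPoly {k : ℕ} (hk : 0 < k) (w : Fin k → ℝ) :
    (filterPoly w).natDegree < k := by
  rw [← Nat.le_sub_one_iff_lt hk]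
  refine natDegree_sum_le_of_forall_le _ _ fun j _ => (natDegree_monomial_le _).trans ?_
  omega

lemma filterPoly_coeff {k : ℕ} {p : ℝ[X]} (hp : p.natDegree < k) :
    filterPoly (fun j : Fin k => p.coeff j) = p := by
  rw [filterPoly, Fin.sum_univ_eq_sum_range fun j => monomial j (p.coeff j)]
  exact (p.as_sum_range' k hp).symm

lemma coeff_filterPoly {k : ℕ} (w : Fin k → ℝ) (j : Fin k) : (filterPoly w).coeff j = w j := by
  simp [filterPoly, coeff_monomial, Fin.val_inj]

lemma toeplitz_mem_convSpace {m n k s : ℕ} {p : ℝ[X]} (hp : p.natDegree < k) :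
    toeplitz m n s p ∈ convSpace m n k s :=
  ⟨fun j => p.coeff j, by rw [convMatrix_eq_toeplitz, filterPoly_coeff hp]⟩

/-- Multiplying a row of coefficients of `a` by rows `X ^ (u * s₁) * p` substitutes `X ^ s₁` into
`a`. The hypothesis `h` keeps the filter `q` from being cut off in the inner dimension. -/
lemma toeplitz_mul_toeplitz {m r n s₁ s₂ : ℕ} {p q : ℝ[X]}
    (h : ∀ i < m, i * s₂ + q.natDegree < r) :
    toeplitz m r s₂ q * toeplitz r n s₁ p = toeplitz m n (s₁ * s₂) (p * expand ℝ s₁ q) := by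
  ext i t
  set a : ℝ[X] := X ^ ((i : ℕ) * s₂) * q with ha
  have hdeg : a.natDegree < r := by
    refine natDegree_mul_le.trans_lt ?_
    rw [natDegree_X_pow]
    exact h i i.2
  have hexp : X ^ ((i : ℕ) * (s₁ * s₂)) * (p * expand ℝ s₁ q) = p * expand ℝ s₁ a := by
    rw [ha, map_mul, map_pow, expand_X, ← pow_mul,
      show s₁ * ((i : ℕ) * s₂) = (i : ℕ) * (s₁ * s₂) by ring]
    ring
  have hsum : expand ℝ s₁ a = ∑ u ∈ Finset.range r, C (a.coeff u) * X ^ (u * s₁) := by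
    conv_lhs => rw [a.as_sum_range_C_mul_X_pow' hdeg]
    simp only [map_sum, map_mul, map_pow, expand_C, expand_X, ← pow_mul]
    exact Finset.sum_congr rfl fun u _ => by rw [mul_comm s₁ u]
  simp only [Matrix.mul_apply, toeplitz, Matrix.of_apply, ← ha]
  rw [hexp, hsum, Finset.mul_sum, finsetSum_coeff,
    Fin.sum_univ_eq_sum_range (fun u : ℕ => a.coeff u * (X ^ (u * s₁) * p : ℝ[X]).coeff (t : ℕ))]
  refine Finset.sum_congr rfl fun u _ => ?_
  rw [← coeff_C_mul]
  congr 1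
  ring

namespace Architecture

/-- The architecture without its last layer. -/
def init {L : ℕ} (A : Architecture (L + 1)) : Architecture L where
  d i := A.d i.castSucc
  k l := A.k l.castSucc
  s l := A.s l.castSucc
  d_pos _ := A.d_pos _
  k_pos _ := A.k_pos _
  s_pos _ := A.s_pos _
  compatible l := A.compatible l.castSucc

lemma d_succ_mul_s {L : ℕ} (A : Architecture L) (l : Fin L) :
    A.d l.succ * A.s l + A.k l = A.d l.castSucc + A.s l := by
  have h := A.compatible l
  have hs : (A.s l : ℚ) ≠ 0 := by exact_mod_cast (A.s_pos l).ne'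
  field_simp at h
  have h' : (A.d l.succ * A.s l + A.k l : ℚ) = A.d l.castSucc + A.s l := by linarith
  exact_mod_cast h'

lemma stride_init {L : ℕ} (A : Architecture (L + 1)) :
    A.stride = A.init.stride * A.s (Fin.last L) := by
  rw [stride, Fin.prod_univ_castSucc]
  rfl

lemma filterSize_init {L : ℕ} (A : Architecture (L + 1)) :
    A.filterSize = A.init.filterSize + (A.k (Fin.last L) - 1) * A.init.stride := by
  have h : ∀ l : Fin (L + 1), (∏ m ∈ Finset.univ.filter (fun m => m < l), A.s m) =
      ∏ m : Fin L, if m.castSucc < l then A.s m.castSucc else 1 := by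
    intro l
    rw [Finset.prod_filter, Fin.prod_univ_castSucc, if_neg (not_lt.2 (Fin.le_last l)), mul_one]
  simp only [filterSize, h]
  rw [Fin.sum_univ_castSucc, ← add_assoc]
  congr 1
  · congr 1
    refine Finset.sum_congr rfl fun l _ => ?_
    rw [Finset.prod_filter]
    simp only [Fin.castSucc_lt_castSucc_iff]
    rfl
  · simp only [Fin.castSucc_lt_last, if_true]
    rfl

lemma stride_pos {L : ℕ} (A : Architecture L) : 0 < A.stride :=
  Finset.prod_pos fun l _ => A.s_pos l

lemma d_last_mul_stride {L : ℕ} (A : Architecture L) :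
    A.d (Fin.last L) * A.stride + A.filterSize = A.d 0 + A.stride := by
  induction L with
  | zero => simp [stride, filterSize]
  | succ L ih =>
    have h1 := A.d_succ_mul_s (Fin.last L)
    have h2 := ih A.init
    have h3 : A.init.d (Fin.last L) = A.d (Fin.last L).castSucc := rfl
    have h4 : A.init.d 0 = A.d 0 := rfl
    obtain ⟨k', hk'⟩ : ∃ k', A.k (Fin.last L) = k' + 1 :=
      ⟨_, (Nat.succ_pred_eq_of_pos (A.k_pos _)).symm⟩
    rw [filterSize_init, stride_init, hk', Nat.add_sub_cancel]
    rw [hk'] at h1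
    rw [h3, h4] at h2
    rw [Fin.succ_last] at h1
    linear_combination h2 + A.init.stride * h1

/-- This ensures that the first row of an ambient matrix displays the whole filter. -/
lemma filterSize_le {L : ℕ} (A : Architecture L) : A.filterSize ≤ A.d 0 := by
  have h1 := A.d_last_mul_stride
  have h2 : 1 * A.stride ≤ A.d (Fin.last L) * A.stride := Nat.mul_le_mul_right _ (A.d_pos _)
  omega

lemma filterSize_pos {L : ℕ} (A : Architecture L) : 0 < A.filterSize := by
  rw [filterSize]; omega

lemma toeplitz_layer_mul {L : ℕ} (A : Architecture L) (l : Fin L) {n s : ℕ} {p q : ℝ[X]}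
    (hq : q.natDegree < A.k l) :
    toeplitz (A.d l.succ) (A.d l.castSucc) (A.s l) q * toeplitz (A.d l.castSucc) n s p =
      toeplitz (A.d l.succ) n (s * A.s l) (p * expand ℝ s q) := by
  refine toeplitz_mul_toeplitz fun i hi => ?_
  have h1 := A.d_succ_mul_s l
  have h2 : (i + 1) * A.s l ≤ A.d l.succ * A.s l := Nat.mul_le_mul_right _ hi
  rw [add_mul, one_mul] at h2
  omega

lemma natDegree_mul_expand_lt {a b s : ℕ} {p q : ℝ[X]} (hp : p.natDegree < a)
    (hq : q.natDegree < b) : (p * expand ℝ s q).natDegree < a + (b - 1) * s := by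
  refine natDegree_mul_le.trans_lt ?_
  rw [natDegree_expand]
  have : q.natDegree * s ≤ (b - 1) * s := Nat.mul_le_mul_right _ (by omega)
  omega

lemma exists_toeplitz_eq_chainProd {L : ℕ} (A : Architecture L)
    (W : (l : Fin L) → Matrix (Fin (A.d l.succ)) (Fin (A.d l.castSucc)) ℝ)
    (hW : ∀ l, W l ∈ convSpace (A.d l.succ) (A.d l.castSucc) (A.k l) (A.s l)) :
    ∃ p : ℝ[X], p.natDegree < A.filterSize ∧
      chainProd L A.d W = toeplitz (A.d (Fin.last L)) (A.d 0) A.stride p := by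
  induction L with
  | zero =>
    refine ⟨1, by simpa using A.filterSize_pos, ?_⟩
    ext i t
    simp [chainProd, toeplitz, stride, coeff_X_pow, Matrix.one_apply, Fin.ext_iff, eq_comm]
  | succ L ih =>
    obtain ⟨p, hp, hpW⟩ := ih A.init (fun l => W l.castSucc) fun l => hW l.castSucc
    obtain ⟨w, hw⟩ := hW (Fin.last L)
    have hq := natDegree_filterPoly (A.k_pos (Fin.last L)) w
    refine ⟨p * expand ℝ A.init.stride (filterPoly w), ?_, ?_⟩
    · rw [filterSize_init]
      exact natDegree_mul_expand_lt hp hq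
    · rw [stride_init]
      refine Eq.trans ?_ (A.toeplitz_layer_mul (Fin.last L) hq)
      rw [← convMatrix_eq_toeplitz, hw]
      exact congrArg (W (Fin.last L) * ·) hpW

lemma exists_factorization {L : ℕ} (A : Architecture (L + 1))
    {V : Matrix (Fin (A.d (Fin.last (L + 1)))) (Fin (A.d 0)) ℝ} (hV : V ∈ A.functionSpace) :
    ∃ p q : ℝ[X], p.natDegree < A.init.filterSize ∧ q.natDegree < A.k (Fin.last L) ∧
      V = toeplitz _ _ A.stride (p * expand ℝ A.init.stride q) := by
  obtain ⟨W, hW, rfl⟩ := hV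
  obtain ⟨p, hp, hpW⟩ := A.init.exists_toeplitz_eq_chainProd (fun l => W l.castSucc)
    fun l => hW l.castSucc
  obtain ⟨w, hw⟩ := hW (Fin.last L)
  have hq := natDegree_filterPoly (A.k_pos (Fin.last L)) w
  refine ⟨p, filterPoly w, hp, hq, ?_⟩
  rw [stride_init]
  refine Eq.trans ?_ (A.toeplitz_layer_mul (Fin.last L) hq)
  rw [← convMatrix_eq_toeplitz, hw]
  exact congrArg (W (Fin.last L) * ·) hpW

lemma functionSpace_subset_ambientSpace {L : ℕ} (A : Architecture L) :
    A.functionSpace ⊆ A.ambientSpace := by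
  rintro _ ⟨W, hW, rfl⟩
  obtain ⟨p, hp, h⟩ := A.exists_toeplitz_eq_chainProd W hW
  rw [h]
  exact toeplitz_mem_convSpace hp

end Architecture

/-! ### The function space as a polynomial image -/

/-- A real function on `ℝ^κ` given by a polynomial. -/
def IsPolynomialFun {κ : Type*} (h : (κ → ℝ) → ℝ) : Prop :=
  ∃ p : MvPolynomial κ ℝ, ∀ w, h w = MvPolynomial.eval w p

namespace IsPolynomialFun

variable {κ : Type*}

lemma const (c : ℝ) : IsPolynomialFun fun _ : κ → ℝ => c := ⟨MvPolynomial.C c, by simp⟩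

lemma coord (i : κ) : IsPolynomialFun fun w : κ → ℝ => w i := ⟨MvPolynomial.X i, by simp⟩

lemma mul {g h : (κ → ℝ) → ℝ} (hg : IsPolynomialFun g) (hh : IsPolynomialFun h) :
    IsPolynomialFun fun w => g w * h w := by
  obtain ⟨p, hp⟩ := hg
  obtain ⟨q, hq⟩ := hh
  exact ⟨p * q, fun w => by simp only [hp, hq, map_mul]⟩

lemma sum {α : Type*} (s : Finset α) {g : α → (κ → ℝ) → ℝ} (hg : ∀ a, IsPolynomialFun (g a)) :
    IsPolynomialFun fun w => ∑ a ∈ s, g a w := by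
  choose p hp using hg
  exact ⟨∑ a ∈ s, p a, fun w => by simp [hp]⟩

lemma convMatrix {m n k s : ℕ} {c : Fin k → (κ → ℝ) → ℝ} (hc : ∀ j, IsPolynomialFun (c j))
    (i : Fin m) (t : Fin n) :
    IsPolynomialFun fun w => LCN.convMatrix m n k s (fun j => c j w) i t := by
  simp only [LCN.convMatrix, Matrix.of_apply]
  refine sum Finset.univ fun j => ?_
  split_ifs
  · exact hc j
  · exact const 0

lemma chainProd (L : ℕ) (d : Fin (L + 1) → ℕ)
    {W : (κ → ℝ) → (l : Fin L) → Matrix (Fin (d l.succ)) (Fin (d l.castSucc)) ℝ}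
    (hW : ∀ l i t, IsPolynomialFun fun w => W w l i t) (i : Fin (d (Fin.last L))) (t : Fin (d 0)) :
    IsPolynomialFun fun w => LCN.chainProd L d (W w) i t := by
  induction L with
  | zero => exact const _
  | succ L ih =>
    simp only [LCN.chainProd]
    refine sum Finset.univ fun u => mul (hW (Fin.last L) i u) ?_
    exact ih (fun i => d i.castSucc) (W := fun w l => W w l.castSucc)
      (fun l => hW l.castSucc) u t

end IsPolynomialFun

lemma Architecture.isSemialgebraic_functionSpace {L : ℕ} (A : Architecture L) :
    IsSemialgebraic (entrySet A.functionSpace) := by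
  let W : ((Σ l, Fin (A.k l)) → ℝ) →
      (l : Fin L) → Matrix (Fin (A.d l.succ)) (Fin (A.d l.castSucc)) ℝ :=
    fun w l => convMatrix _ _ _ (A.s l) fun j => w ⟨l, j⟩
  have hW : ∀ l i t, IsPolynomialFun fun w => W w l i t := fun l i t =>
    IsPolynomialFun.convMatrix (fun j => IsPolynomialFun.coord _) i t
  choose φ hφ using IsPolynomialFun.chainProd L A.d hW
  have h := TarskiSeidenberg.isSemialgebraic_range
    fun p : Fin (A.d (Fin.last L)) × Fin (A.d 0) => φ p.1 p.2
  convert h using 1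
  ext z
  constructor
  · rintro ⟨_, ⟨V, hV, rfl⟩, rfl⟩
    choose w hw using hV
    refine ⟨fun j => w j.1 j.2, funext fun p => ?_⟩
    refine (hφ _ _ _).symm.trans ?_
    simp only [W, hw]
  · rintro ⟨w, rfl⟩
    refine ⟨_, ⟨W w, fun l => ⟨_, rfl⟩, rfl⟩, funext fun p => ?_⟩
    exact hφ _ _ _

/-! ### Parameter count and dimension -/

/-- Products `p * q(X ^ s)` with `deg p < a` and `deg q < b` depend on `a + b - 1` parameters up to
scaling, so longer coefficient sequences satisfy a polynomial relation. -/
lemma exists_relation {a b K : ℕ} (s : ℕ) (hb : 0 < b) (hK : a + (b - 1) < K) :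
    ∃ f : MvPolynomial (Fin K) ℝ, f ≠ 0 ∧ ∀ p q : ℝ[X], p.natDegree < a → q.natDegree < b →
      MvPolynomial.eval (fun j : Fin K => (p * expand ℝ s q).coeff j) f = 0 := by
  -- Scaling is used to fix the constant coefficient of `q` to `1`, which leaves `b - 1` variables
  -- for `q`.
  let σ := Fin a ⊕ Fin (b - 1)
  let P : (MvPolynomial σ ℝ)[X] := ∑ i : Fin a, monomial (i : ℕ) (MvPolynomial.X (Sum.inl i))
  let Q : (MvPolynomial σ ℝ)[X] :=
    1 + ∑ i : Fin (b - 1), monomial ((i : ℕ) + 1) (MvPolynomial.X (Sum.inr i))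
  let φ : Fin K → MvPolynomial σ ℝ := fun j => (P * expand _ s Q).coeff j
  have hφ : ¬ AlgebraicIndependent ℝ φ := by
    intro h
    have := h.lift_cardinalMk_le_trdeg
    rw [MvPolynomial.trdeg_of_isDomain] at this
    simp [σ] at this
    norm_cast at this
    omega
  obtain ⟨f, hf, hf0⟩ : ∃ f : MvPolynomial (Fin K) ℝ, MvPolynomial.aeval φ f = 0 ∧ f ≠ 0 := by
    rw [algebraicIndependent_iff] at hφ
    push Not at hφ
    exact hφ
  have h1 : ∀ p q : ℝ[X], p.natDegree < a → q.natDegree < b → q.coeff 0 = 1 →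
      MvPolynomial.eval (fun j : Fin K => (p * expand ℝ s q).coeff j) f = 0 := by
    intro p q hp hq hq0
    let w : σ → ℝ := Sum.elim (fun i => p.coeff i) fun i => q.coeff (i + 1)
    have hP : P.map (MvPolynomial.eval w) = p := by
      simp only [P, Polynomial.map_sum, map_monomial, MvPolynomial.eval_X, w, Sum.elim_inl]
      exact filterPoly_coeff hp
    have hQ : Q.map (MvPolynomial.eval w) = q := by
      simp only [Q, Polynomial.map_add, Polynomial.map_one, Polynomial.map_sum, map_monomial,
        MvPolynomial.eval_X, w, Sum.elim_inr]
      rw [Fin.sum_univ_eq_sum_range fun j => monomial (j + 1) (q.coeff (j + 1))]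
      conv_rhs => rw [q.as_sum_range' b hq, ← Nat.sub_add_cancel hb, Finset.sum_range_succ', hq0]
      rw [add_comm, monomial_zero_left, C_1]
    have hw : ∀ j, MvPolynomial.eval w (φ j) = (p * expand ℝ s q).coeff j := by
      intro j
      conv_rhs => rw [← hP, ← hQ, ← map_expand, ← Polynomial.map_mul, coeff_map]
    have := congrArg (MvPolynomial.eval w) hf
    rw [map_zero, MvPolynomial.aeval_def, ← MvPolynomial.coe_eval₂Hom, ← RingHom.comp_apply,
      MvPolynomial.comp_eval₂Hom] at this
    simp only [hw] at this
    convert this using 1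
    rw [MvPolynomial.eval, MvPolynomial.coe_eval₂Hom, MvPolynomial.coe_eval₂Hom]
    congr 1
    ext r
    simp
  have h2 : ∀ p q : ℝ[X], p.natDegree < a → q.natDegree < b → q.coeff 0 ≠ 0 →
      MvPolynomial.eval (fun j : Fin K => (p * expand ℝ s q).coeff j) f = 0 := by
    intro p q hp hq hq0
    have := h1 (C (q.coeff 0) * p) (C (q.coeff 0)⁻¹ * q) ((natDegree_C_mul_le _ _).trans_lt hp)
      ((natDegree_C_mul_le _ _).trans_lt hq) (by rw [coeff_C_mul, inv_mul_cancel₀ hq0])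
    rwa [map_mul, expand_C, mul_mul_mul_comm, ← C_mul, mul_inv_cancel₀ hq0, C_1, one_mul] at this
  refine ⟨f, hf0, fun p q hp hq => ?_⟩
  by_cases hq0 : q.coeff 0 = 0
  -- A vanishing constant coefficient cannot be normalized; it is reached as the limit of `q + C e`
  -- for `e → 0`.
  · have hcont : Continuous fun e : ℝ =>
        MvPolynomial.eval (fun j : Fin K => (p * expand ℝ s (q + C e)).coeff j) f := by
      refine (MvPolynomial.continuous_eval f).comp (continuous_pi fun j => ?_)
      simp only [map_add, expand_C, mul_add, coeff_add, coeff_mul_C]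
      fun_prop
    have heq := hcont.ext_on (dense_compl_singleton (0 : ℝ)) continuous_const
      (fun e he => h2 p (q + C e) hp
        (by rwa [natDegree_add_C]) (by simpa [hq0] using he))
    simpa using congrFun heq 0
  · exact h2 p q hp hq hq0

section Dimension

variable {m n K s : ℕ}

/-- Pullback of polynomial functions along `w ↦ convMatrix m n K s w`. -/
noncomputable def pullback (m n K s : ℕ) :
    MvPolynomial (Fin m × Fin n) ℝ →ₐ[ℝ] MvPolynomial (Fin K) ℝ :=
  MvPolynomial.aeval fun p =>
    ∑ j : Fin K, if (p.2 : ℕ) = (p.1 : ℕ) * s + (j : ℕ) then MvPolynomial.X j else 0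

lemma eval_pullback (w : Fin K → ℝ) (g : MvPolynomial (Fin m × Fin n) ℝ) :
    MvPolynomial.eval w (pullback m n K s g) =
      MvPolynomial.eval (fun p => convMatrix m n K s w p.1 p.2) g := by
  have : (MvPolynomial.aeval w).comp (pullback m n K s) =
      MvPolynomial.aeval fun p : Fin m × Fin n => convMatrix m n K s w p.1 p.2 := by
    apply MvPolynomial.algHom_ext
    intro p
    simp [pullback, convMatrix, apply_ite]
  have := AlgHom.congr_fun this g
  simpa [MvPolynomial.aeval_eq_eval] using this

/-- The section of `pullback` reading the filter off the first row. -/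
noncomputable def firstRow (hm : 0 < m) (hK : K ≤ n) :
    MvPolynomial (Fin K) ℝ →ₐ[ℝ] MvPolynomial (Fin m × Fin n) ℝ :=
  MvPolynomial.aeval fun j => MvPolynomial.X (⟨0, hm⟩, Fin.castLE hK j)

lemma pullback_firstRow (hm : 0 < m) (hK : K ≤ n) (h : MvPolynomial (Fin K) ℝ) :
    pullback m n K s (firstRow hm hK h) = h := by
  have : (pullback m n K s).comp (firstRow hm hK) = AlgHom.id ℝ _ := by
    apply MvPolynomial.algHom_ext
    intro j
    simp [pullback, firstRow, Fin.val_inj]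
  exact AlgHom.congr_fun this h

lemma mem_vanishingIdeal_entrySet {S : Set (Matrix (Fin m) (Fin n) ℝ)}
    (hS : S ⊆ convSpace m n K s) (g : MvPolynomial (Fin m × Fin n) ℝ) :
    g ∈ MvPolynomial.vanishingIdeal ℝ (entrySet S) ↔
      ∀ w, convMatrix m n K s w ∈ S → MvPolynomial.eval w (pullback m n K s g) = 0 := by
  rw [MvPolynomial.mem_vanishingIdeal_iff]
  simp only [eval_pullback, MvPolynomial.aeval_eq_eval]
  constructor
  · intro h w hw
    exact h _ ⟨_, hw, rfl⟩
  · rintro h _ ⟨V, hV, rfl⟩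
    obtain ⟨w, rfl⟩ := hS hV
    exact h w hV

/-- The dimension drops on a subset of the convolutional matrices on whose filters a nonzero
polynomial vanishes. -/
lemma semialgebraicDim_lt (hm : 0 < m) (hK : K ≤ n) {S : Set (Matrix (Fin m) (Fin n) ℝ)}
    (hS : S ⊆ convSpace m n K s) {f : MvPolynomial (Fin K) ℝ} (hf0 : f ≠ 0)
    (hf : ∀ w, convMatrix m n K s w ∈ S → MvPolynomial.eval w f = 0) :
    semialgebraicDim (entrySet S) < semialgebraicDim (entrySet (convSpace m n K s)) := by
  set I := MvPolynomial.vanishingIdeal ℝ (entrySet S) with hI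
  have hker : ∀ g, pullback m n K s g = 0 → g ∈ I := fun g hg =>
    (mem_vanishingIdeal_entrySet hS g).2 fun w _ => by rw [hg, map_zero]
  have hlow : ringKrullDim (MvPolynomial (Fin K) ℝ) ≤
      semialgebraicDim (entrySet (convSpace m n K s)) := by
    refine ringKrullDim_le_of_surjective
      (Ideal.Quotient.lift _ (pullback m n K s : _ →+* MvPolynomial (Fin K) ℝ) fun g hg => ?_) ?_
    · apply MvPolynomial.funext
      intro w
      rw [map_zero]
      exact (mem_vanishingIdeal_entrySet subset_rfl g).1 hg w ⟨w, rfl⟩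
    · intro h
      exact ⟨Ideal.Quotient.mk _ (firstRow hm hK h), pullback_firstRow hm hK h⟩
  have hup : semialgebraicDim (entrySet S) ≤
      ringKrullDim (MvPolynomial (Fin K) ℝ ⧸ Ideal.span {f}) := by
    -- On `S` every coordinate function is a polynomial in the first row, and the first row
    -- satisfies `f`.
    refine ringKrullDim_le_of_surjective
      (Ideal.Quotient.lift _ ((Ideal.Quotient.mk I).comp
        (firstRow hm hK : MvPolynomial (Fin K) ℝ →+* _)) fun g hg => ?_) ?_
    · obtain ⟨c, rfl⟩ := Ideal.mem_span_singleton'.1 hg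
      refine Ideal.Quotient.eq_zero_iff_mem.2 ((mem_vanishingIdeal_entrySet hS _).2 fun w hw => ?_)
      refine (congrArg _ (pullback_firstRow hm hK (c * f))).trans ?_
      rw [map_mul, hf w hw, mul_zero]
    · intro z
      obtain ⟨g, rfl⟩ := Ideal.Quotient.mk_surjective z
      refine ⟨Ideal.Quotient.mk _ (pullback m n K s g), ?_⟩
      refine (Ideal.Quotient.eq (I := I)).2 (hker _ ?_)
      rw [map_sub, sub_eq_zero]
      exact pullback_firstRow hm hK _
  have hdrop := ringKrullDim_quotient_succ_le_of_nonZeroDivisor (mem_nonZeroDivisors_of_ne_zero hf0)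
  have hdim : ringKrullDim (MvPolynomial (Fin K) ℝ) = (K : ℕ) := by
    rw [MvPolynomial.ringKrullDim_of_isNoetherianRing, ringKrullDim_eq_zero_of_field]
    simp
  refine hup.trans_lt (lt_of_lt_of_le ?_ hlow)
  rw [hdim] at hdrop ⊢
  generalize ringKrullDim (MvPolynomial (Fin K) ℝ ⧸ Ideal.span {f}) = r at hdrop ⊢
  induction r with
  -- The case of a zero quotient ring, when `f` is a unit.
  | bot => exact WithBot.bot_lt_coe _
  | coe r =>
    have h1 : r + 1 ≤ (K : ℕ∞) := by exact_mod_cast hdrop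
    have h2 : r < (K : ℕ∞) := by
      rw [← ENat.add_one_le_iff (ne_top_of_le_ne_top (ENat.natCast_ne_top K)
        (le_self_add.trans h1))]
      exact h1
    exact_mod_cast h2

end Dimension

end LCN

/-- The network has `n + 1` layers; `Fin.last n` is the last one, and `i.castSucc` for `i : Fin n`
runs over the others. -/
theorem mainTheorem9 {n : ℕ} (A : LCN.Architecture (n + 1))
    (hk : 1 < A.k (Fin.last n)) (hs : ∃ i : Fin n, 1 < A.s i.castSucc) :
    ¬ A.IsFilling ∧
      A.functionSpace ⊆ A.ambientSpace ∧
      LCN.IsSemialgebraic (LCN.entrySet A.functionSpace) ∧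
      LCN.semialgebraicDim (LCN.entrySet A.functionSpace) <
        LCN.semialgebraicDim (LCN.entrySet A.ambientSpace) := by
  have hsub := A.functionSpace_subset_ambientSpace
  have hstride : 1 < A.init.stride := by
    obtain ⟨i, hi⟩ := hs
    exact hi.trans_le (Nat.le_of_dvd A.init.stride_pos
      (Finset.dvd_prod_of_mem A.init.s (Finset.mem_univ i)))
  have hlt : A.init.filterSize + (A.k (Fin.last n) - 1) < A.filterSize := by
    rw [A.filterSize_init]
    have : (A.k (Fin.last n) - 1) * 1 < (A.k (Fin.last n) - 1) * A.init.stride :=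
      Nat.mul_lt_mul_of_pos_left hstride (by omega)
    omega
  obtain ⟨f, hf0, hf⟩ := LCN.exists_relation A.init.stride (A.k_pos _) hlt
  have hdim : LCN.semialgebraicDim (LCN.entrySet A.functionSpace) <
      LCN.semialgebraicDim (LCN.entrySet A.ambientSpace) := by
    refine LCN.semialgebraicDim_lt (A.d_pos _) A.filterSize_le hsub hf0 fun w hw => ?_
    obtain ⟨p, q, hp, hq, h⟩ := A.exists_factorization hw
    convert hf p q hp hq using 2
    congr 1
    funext j
    -- Row `0` is not shifted, so its entries are the filter coefficients themselves.
    have h0 := congrFun (congrFun h ⟨0, A.d_pos _⟩) (Fin.castLE A.filterSize_le j)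
    rw [LCN.convMatrix_eq_toeplitz] at h0
    simp only [LCN.toeplitz, Matrix.of_apply, zero_mul, pow_zero, one_mul, Fin.val_castLE] at h0
    rwa [LCN.coeff_filterPoly] at h0
  refine ⟨fun hfill => ?_, hsub, A.isSemialgebraic_functionSpace, hdim⟩
  rw [LCN.Architecture.IsFilling] at hfill
  rw [hfill] at hdim
  exact lt_irrefl _ hdim
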